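/- Say that a matrix $A\in\mathbb{R}^{n\times N}$ satisfies the restricted isometry property (RIP) of order $s$ with constant $\delta\in(0,1)$ if $$(1-\delta)\|z\|_2^2\le\|A_Tz\|_2^2\le(1+\delta)\|z\|_2^2$$ for all $T\subset\{1,\dots,N\}$ with $|T|\le s$ and all $z\in\mathbb{R}^{|T|}$, where $A_T$ consists of the columns of $A$ with index in $T$. For positive integers $k,l,d,e$ put $n=ld$, $N=ke$, and consider the truncated Toeplitz block matrix $$\Phi=\begin{pmatrix}\Phi_k&\Phi_{k-1}&\cdots&\Phi_2&\Phi_1\\ \Phi_{k+1}&\Phi_k&\cdots&\Phi_3&\Phi_2\\ \vdots&\vdots&\ddots&\ddots&\vdots\\ \Phi_{k+l-1}&\Phi_{k+l-2}&\cdots&\cdots&\Phi_l\end{pmatrix}\in\mathbb{R}^{n\times N},$$ with blocks $\Phi_1,\dots,\Phi_{k+l-1}\in\mathbb{R}^{d\times e}$, where the entries of all the blocks are mutually independent random variables with a common distribution, which is one of the following three: the normal distribution $N(0,1/n)$; the values $\pm1/\sqrt n$ with probability $1/2$ each; the values $\pm\sqrt{3/n}$ with probability $1/6$ each and $0$ with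 probability $2/3$. For every $\delta\in(0,1)$ there exist constants $c_1,c_2>0$ depending only on $\delta$ such that, for each of the three distributions and all positive integers $m,k,l,d,e$ with $3m\le N$, the following holds. (i) If $l\le 3m(3m-1)$ and $n\ge c_1\,l\,m\ln(N/m)$, then $\Phi$ satisfies RIP of order $3m$ with constant $\delta$ with probability at least $1-e^{-c_2n/l}$. (ii) If $l>3m(3m-1)$ and $n\ge c_1\,m^3\ln(N/m)$, then $\Phi$ satisfies RIP of order $3m$ with constant $\delta$ with probability at least $1-e^{-c_2n/m^2}$. -/

import Mathlib

open MeasureTheory ProbabilityTheory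
open scoped NNReal ENNReal

/-- The three admissible distributions of the entries of the random blocks. -/
inductive EntryDistribution where
  | gaussian
  | bernoulli
  | ternary

/-- The law of an entry of a matrix with `n` rows: the normal law `N(0, 1/n)`, or `±1/√n` with
probability `1/2` each, or `±√(3/n)` with probability `1/6` each and `0` with
probability `2/3`. -/
noncomputable def EntryDistribution.law (P : EntryDistribution) (n : ℕ) : Measure ℝ :=
  match P with
  | .gaussian => gaussianReal 0 (1 / (n : ℝ≥0))
  | .bernoulli =>
      (1 / 2 : ℝ≥0∞) • Measure.dirac (1 / √(n : ℝ)) +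
        (1 / 2 : ℝ≥0∞) • Measure.dirac (-(1 / √(n : ℝ)))
  | .ternary =>
      (1 / 6 : ℝ≥0∞) • Measure.dirac (√(3 / (n : ℝ))) +
        (2 / 3 : ℝ≥0∞) • Measure.dirac (0 : ℝ) +
        (1 / 6 : ℝ≥0∞) • Measure.dirac (-√(3 / (n : ℝ)))

/-- The truncated Toeplitz block matrix with `l` block rows and `k` block columns built from
the `d × e` blocks `B 0, …, B (k + l - 2)`. Counting everything from `0`, the block in
position `(i, j)` is `B (i + (k - 1 - j))`: the first block row is
`B (k - 1), …, B 1, B 0` and the last one is `B (k + l - 2), …, B (l - 1)`. -/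
def toeplitzBlock {k l d e : ℕ} (B : Fin (k + l - 1) → Matrix (Fin d) (Fin e) ℝ) :
    Matrix (Fin l × Fin d) (Fin k × Fin e) ℝ :=
  fun p q => B ⟨p.1 + (k - 1 - q.1), by have := p.1.isLt; have := q.1.isLt; omega⟩ p.2 q.2

/-- The restricted isometry property of order `s` with constant `δ`; the norms are
Euclidean and `A.submatrix id (↑)` retains the columns with index in `T`. -/
def SatisfiesRIP {ι κ : Type*} [Fintype ι] (A : Matrix ι κ ℝ) (s : ℕ) (δ : ℝ) : Prop :=
  ∀ T : Finset κ, T.card ≤ s → ∀ z : EuclideanSpace ℝ T,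
    (1 - δ) * ‖z‖ ^ 2 ≤
        ‖WithLp.toLp 2 ((A.submatrix id (fun t : T => (t : κ))).mulVec z.ofLp)‖ ^ 2 ∧
      ‖WithLp.toLp 2 ((A.submatrix id (fun t : T => (t : κ))).mulVec z.ofLp)‖ ^ 2 ≤
        (1 + δ) * ‖z‖ ^ 2

/-! Fix a support `T` of size `3m` and a unit vector `x`. Each coordinate of `√n Φ_T x` is a
combination of independent entries with mean 0, variance 1 and sub-Gaussian parameter 3, so its
centred square has moment generating function at most `exp (C θ²)` for small `θ`
(`lintegral_exp_mul_sq_sub_one_le`). The coordinates are dependent, because block rows share blocks.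
If the block rows are coloured with `q` colours so that rows of one colour use disjoint entries,
Hölder over the colour classes costs a factor `q` in the exponent (`lintegral_exp_sum_sq_le`).
Chernoff then gives the deviation bound `2 exp (-c η² n / q)` for one vector
(`measure_sum_sq_deviation_le`).

For (i), every block row gets its own colour, so `q = l`. For (ii), a greedy colouring uses
`3m(3m-1)+1 ≤ 9m²` colours (`exists_isBlockRowColoring`).

A union bound over a net of the unit ball and over all supports (`measure_not_satisfiesRIP_le`) adds
an entropy of order `m ln(N/m)`, which the row condition makes at most half of the deviation
exponent; `near_isometry_of_net` extends the estimate from the net to all vectors. -/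

/-! ### Exponential moments of squares of sub-Gaussian variables -/

/-- The Gaussian bound for `𝔼 exp (Y² / 12)` when `Y` is sub-Gaussian with parameter `3`. -/
noncomputable def expSqBound : ℝ := ∫ g, Real.exp (g ^ 2 / 4) ∂(gaussianReal 0 1)

lemma integrable_exp_sq_div_four_gaussianReal :
    Integrable (fun g : ℝ => Real.exp (g ^ 2 / 4)) (gaussianReal 0 1) := by
  rw [gaussianReal_of_var_ne_zero 0 one_ne_zero,
    integrable_withDensity_iff_integrable_smul₀' (by fun_prop)
      (ae_of_all _ fun x => by simp [gaussianPDF])]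
  have h := (integrable_exp_neg_mul_sq (b := 1 / 4) (by norm_num)).const_mul ((√(2 * Real.pi))⁻¹)
  refine h.congr (ae_of_all _ fun x => ?_)
  simp only [gaussianPDF, smul_eq_mul]
  rw [ENNReal.toReal_ofReal (gaussianPDFReal_nonneg _ _ _)]
  simp only [gaussianPDFReal, NNReal.coe_one, mul_one, sub_zero]
  rw [mul_assoc, ← Real.exp_add]
  congr 2
  ring

/-- Linearise the square with an auxiliary standard Gaussian `g`: `exp (Y²/12) = 𝔼_g exp (Y g/√6)`.
After Tonelli, the sub-Gaussian bound at `g/√6` yields `exp (3 · (g²/6) / 2) = exp (g²/4)`. -/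
lemma lintegral_exp_sq_le {Ω : Type*} [MeasurableSpace Ω] {μ : Measure Ω} [IsProbabilityMeasure μ]
    {Y : Ω → ℝ} (hY : HasSubgaussianMGF Y 3 μ) :
    ∫⁻ ω, ENNReal.ofReal (Real.exp (Y ω ^ 2 / 12)) ∂μ ≤ ENNReal.ofReal expSqBound := by
  have hs : (√6)⁻¹ ^ 2 = (1 / 6 : ℝ) := by
    rw [inv_pow, Real.sq_sqrt (by norm_num)]; norm_num
  have key : ∀ ω, ENNReal.ofReal (Real.exp (Y ω ^ 2 / 12))
      = ∫⁻ g, ENNReal.ofReal (Real.exp ((√6)⁻¹ * Y ω * g)) ∂(gaussianReal 0 1) := by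
    intro ω
    rw [← ofReal_integral_eq_lintegral_ofReal (integrable_exp_mul_gaussianReal _)
      (ae_of_all _ fun _ => (Real.exp_pos _).le)]
    have := congrFun (mgf_fun_id_gaussianReal (μ := 0) (v := 1)) ((√6)⁻¹ * Y ω)
    rw [mgf] at this
    rw [this]
    congr 2
    rw [mul_pow, hs]
    push_cast
    ring
  have hm : AEMeasurable Y μ := hY.aemeasurable
  calc ∫⁻ ω, ENNReal.ofReal (Real.exp (Y ω ^ 2 / 12)) ∂μ
      = ∫⁻ ω, ∫⁻ g, ENNReal.ofReal (Real.exp ((√6)⁻¹ * Y ω * g)) ∂(gaussianReal 0 1) ∂μ :=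
        lintegral_congr key
    _ = ∫⁻ g, ∫⁻ ω, ENNReal.ofReal (Real.exp ((√6)⁻¹ * Y ω * g)) ∂μ ∂(gaussianReal 0 1) := by
        refine lintegral_lintegral_swap ?_
        have h1 : AEMeasurable (fun p : Ω × ℝ => Y p.1) (μ.prod (gaussianReal 0 1)) := hm.comp_fst
        have h2 : AEMeasurable (fun p : Ω × ℝ => p.2) (μ.prod (gaussianReal 0 1)) :=
          measurable_snd.aemeasurable
        exact (((h1.const_mul _).mul h2).exp).ennreal_ofReal
    _ ≤ ∫⁻ g, ENNReal.ofReal (Real.exp (g ^ 2 / 4)) ∂(gaussianReal 0 1) := by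
        refine lintegral_mono fun g => ?_
        have h1 : ∀ ω, Real.exp ((√6)⁻¹ * Y ω * g) = Real.exp (((√6)⁻¹ * g) * Y ω) :=
          fun ω => by ring_nf
        simp_rw [h1]
        rw [← ofReal_integral_eq_lintegral_ofReal (hY.integrable_exp_mul _)
          (ae_of_all _ fun _ => (Real.exp_pos _).le)]
        refine ENNReal.ofReal_le_ofReal ((hY.mgf_le _).trans (Real.exp_le_exp.2 ?_))
        rw [mul_pow, hs]
        push_cast
        linarith
    _ = ENNReal.ofReal expSqBound :=
        (ofReal_integral_eq_lintegral_ofReal integrable_exp_sq_div_four_gaussianReal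
          (ae_of_all _ fun _ => (Real.exp_pos _).le)).symm

lemma one_le_expSqBound : 1 ≤ expSqBound := by
  have h : ∫ _ : ℝ, (1 : ℝ) ∂(gaussianReal 0 1) ≤ expSqBound :=
    integral_mono (integrable_const _) integrable_exp_sq_div_four_gaussianReal
      fun g => Real.one_le_exp (by positivity)
  simpa using h

/-- The variance proxy in the bound for the moment generating function of `Y² - 1`. -/
noncomputable def mgfSqConst : ℝ := 1152 * Real.exp (1 / 12) * expSqBound

lemma le_mgfSqConst : 1152 ≤ mgfSqConst := by
  have h1 : 1 ≤ Real.exp (1 / 12) := Real.one_le_exp (by norm_num)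
  have h2 := one_le_expSqBound
  have h3 : 1 ≤ Real.exp (1 / 12) * expSqBound := one_le_mul_of_one_le_of_one_le h1 h2
  unfold mgfSqConst
  linarith

lemma exp_le_one_add_add_sq_mul (u : ℝ) : Real.exp u ≤ 1 + u + u ^ 2 * Real.exp |u| := by
  rcases le_or_gt |u| 1 with h | h
  · have h1 := Real.abs_exp_sub_one_sub_id_le h
    have h2 : 1 ≤ Real.exp |u| := Real.one_le_exp (abs_nonneg u)
    have h3 := (abs_le.1 h1).2
    nlinarith [sq_nonneg u]
  · have h1 : Real.exp u ≤ Real.exp |u| := Real.exp_le_exp.2 (le_abs_self u)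
    have h2 : |u| + 1 ≤ Real.exp |u| := Real.add_one_le_exp _
    have h3 : 0 ≤ u ^ 2 - 1 := by rw [← sq_abs]; nlinarith
    have h4 : 1 ≤ Real.exp |u| := Real.one_le_exp (abs_nonneg u)
    rcases le_total 0 u with h0 | h0
    · nlinarith
    · rw [abs_of_nonpos h0] at *
      have h5 : Real.exp u ≤ 1 := Real.exp_le_one_iff.2 h0
      nlinarith

lemma sq_mul_exp_le {θ y : ℝ} (hθ : |θ| ≤ 1 / 24) :
    (θ * (y ^ 2 - 1)) ^ 2 * Real.exp |θ * (y ^ 2 - 1)| ≤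
      θ ^ 2 * (1152 * Real.exp (1 / 12)) * Real.exp (y ^ 2 / 12) := by
  set w := y ^ 2 + 1 with hw
  have hw0 : 0 ≤ w := by positivity
  have habs : |y ^ 2 - 1| ≤ w := by
    rw [abs_le]; constructor <;> nlinarith [sq_nonneg y]
  -- The constant is `1152 = 2 · 24²`, from `u²/2 ≤ exp u` at `u = w/24`.
  have h1 : (y ^ 2 - 1) ^ 2 ≤ 1152 * Real.exp (w / 24) := by
    have h2 : (w / 24) ^ 2 / 2 ≤ Real.exp (w / 24) := by
      have := Real.pow_div_factorial_le_exp (x := w / 24) (by positivity) 2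
      simpa using this
    have h3 : (y ^ 2 - 1) ^ 2 ≤ w ^ 2 := sq_le_sq' (abs_le.1 habs).1 (abs_le.1 habs).2
    nlinarith
  have h4 : Real.exp |θ * (y ^ 2 - 1)| ≤ Real.exp (w / 24) := by
    rw [Real.exp_le_exp, abs_mul]
    calc |θ| * |y ^ 2 - 1| ≤ 1 / 24 * w := by gcongr
      _ = w / 24 := by ring
  calc (θ * (y ^ 2 - 1)) ^ 2 * Real.exp |θ * (y ^ 2 - 1)|
      = θ ^ 2 * (y ^ 2 - 1) ^ 2 * Real.exp |θ * (y ^ 2 - 1)| := by ring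
    _ ≤ θ ^ 2 * (1152 * Real.exp (w / 24)) * Real.exp (w / 24) := by gcongr
    _ = θ ^ 2 * 1152 * (Real.exp (w / 24) * Real.exp (w / 24)) := by ring
    _ = θ ^ 2 * 1152 * (Real.exp (1 / 12) * Real.exp (y ^ 2 / 12)) := by
        rw [← Real.exp_add, ← Real.exp_add]; congr 2; rw [hw]; ring
    _ = _ := by ring

/-- The linear term of the expansion has mean zero because `𝔼 Y² = 1`; the quadratic remainder is
controlled by `𝔼 exp (Y²/12)`. -/
lemma lintegral_exp_mul_sq_sub_one_le {Ω : Type*} [MeasurableSpace Ω] {μ : Measure Ω}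
    [IsProbabilityMeasure μ] {Y : Ω → ℝ} (hY : HasSubgaussianMGF Y 3 μ)
    (hvar : ∫ ω, Y ω ^ 2 ∂μ = 1) {θ : ℝ} (hθ : |θ| ≤ 1 / 24) :
    ∫⁻ ω, ENNReal.ofReal (Real.exp (θ * (Y ω ^ 2 - 1))) ∂μ ≤
      ENNReal.ofReal (Real.exp (mgfSqConst * θ ^ 2)) := by
  have hm : AEMeasurable Y μ := hY.aemeasurable
  have hb := lintegral_exp_sq_le hY
  have hexp_nn : ∀ ω, 0 ≤ Real.exp (Y ω ^ 2 / 12) := fun ω => (Real.exp_pos _).le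
  have hi : Integrable (fun ω => Real.exp (Y ω ^ 2 / 12)) μ := by
    refine ⟨((hm.pow_const 2).div_const 12).exp.aestronglyMeasurable, ?_⟩
    rw [hasFiniteIntegral_iff_ofReal (ae_of_all _ hexp_nn)]
    exact hb.trans_lt ENNReal.ofReal_lt_top
  have hib : ∫ ω, Real.exp (Y ω ^ 2 / 12) ∂μ ≤ expSqBound := by
    rw [← ofReal_integral_eq_lintegral_ofReal hi (ae_of_all _ hexp_nn)] at hb
    exact (ENNReal.ofReal_le_ofReal_iff (zero_le_one.trans one_le_expSqBound)).1 hb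
  have hi2 : Integrable (fun ω => Y ω ^ 2) μ := (hY.memLp 2).integrable_sq
  have hbd : ∀ ω, Real.exp (θ * (Y ω ^ 2 - 1)) ≤ 1 + θ * (Y ω ^ 2 - 1) +
      θ ^ 2 * (1152 * Real.exp (1 / 12)) * Real.exp (Y ω ^ 2 / 12) := fun ω =>
    (exp_le_one_add_add_sq_mul _).trans (add_le_add_right (sq_mul_exp_le hθ) _)
  have hi5 : Integrable (fun ω => θ * (Y ω ^ 2 - 1)) μ :=
    (hi2.sub (integrable_const _)).const_mul θ
  have hi3 : Integrable (fun ω => 1 + θ * (Y ω ^ 2 - 1)) μ := (integrable_const _).add hi5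
  have hi4 := hi.const_mul (θ ^ 2 * (1152 * Real.exp (1 / 12)))
  calc ∫⁻ ω, ENNReal.ofReal (Real.exp (θ * (Y ω ^ 2 - 1))) ∂μ
      ≤ ∫⁻ ω, ENNReal.ofReal (1 + θ * (Y ω ^ 2 - 1) +
      θ ^ 2 * (1152 * Real.exp (1 / 12)) * Real.exp (Y ω ^ 2 / 12)) ∂μ :=
        lintegral_mono fun ω => ENNReal.ofReal_le_ofReal (hbd ω)
    _ = ENNReal.ofReal (∫ ω, (1 + θ * (Y ω ^ 2 - 1) +
      θ ^ 2 * (1152 * Real.exp (1 / 12)) * Real.exp (Y ω ^ 2 / 12)) ∂μ) :=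
        (ofReal_integral_eq_lintegral_ofReal (hi3.add hi4)
          (ae_of_all _ fun ω => (Real.exp_pos _).le.trans (hbd ω))).symm
    _ ≤ _ := by
        refine ENNReal.ofReal_le_ofReal ?_
        rw [integral_add hi3 hi4, integral_add (integrable_const _) hi5, integral_const_mul, integral_const_mul,
          integral_sub hi2 (integrable_const _), hvar]
        simp only [integral_const, probReal_univ, smul_eq_mul, mul_one, sub_self, mul_zero,
          add_zero]
        have h1 : θ ^ 2 * (1152 * Real.exp (1 / 12)) * ∫ ω, Real.exp (Y ω ^ 2 / 12) ∂μ
            ≤ mgfSqConst * θ ^ 2 := by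
          calc _ ≤ θ ^ 2 * (1152 * Real.exp (1 / 12)) * expSqBound := by gcongr
            _ = _ := by unfold mgfSqConst; ring
        linarith [Real.add_one_le_exp (mgfSqConst * θ ^ 2)]

/-! ### Concentration when only rows of equal colour are independent -/

/-- Nonnegative functions of disjoint blocks of independent variables have multiplicative
expectations. -/
lemma lintegral_prod_of_pairwiseDisjoint {Ω ι R : Type*} [MeasurableSpace Ω] {μ : Measure Ω}
    {ξ : ι → Ω → ℝ} (hind : iIndepFun ξ μ) (hm : ∀ i, AEMeasurable (ξ i) μ)
    (s : Finset R) (J : R → Finset ι) (hJ : (s : Set R).PairwiseDisjoint J)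
    (g : ∀ r, (J r → ℝ) → ℝ≥0∞) (hg : ∀ r, Measurable (g r)) :
    ∫⁻ ω, ∏ r ∈ s, g r (fun i => ξ i ω) ∂μ = ∏ r ∈ s, ∫⁻ ω, g r (fun i => ξ i ω) ∂μ := by
  classical
  have := hind.isProbabilityMeasure
  have hmg : ∀ r, AEMeasurable (fun ω => g r (fun i => ξ i ω)) μ := fun r =>
    (hg r).comp_aemeasurable (aemeasurable_pi_lambda _ fun i => hm i)
  induction s using Finset.induction_on with
  | empty => simp
  | insert a s ha ih =>
    simp only [Finset.prod_insert ha]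
    have hdis : Disjoint (J a) (s.biUnion J) := by
      rw [Finset.disjoint_biUnion_right]
      intro r hr
      exact hJ (by simp) (by simp [hr]) (by rintro rfl; exact ha hr)
    have hI := hind.indepFun_finset₀ (J a) (s.biUnion J) hdis hm
    have hsub : ∀ r : s, J r ⊆ s.biUnion J := fun r => Finset.subset_biUnion_of_mem J r.2
    have hI' := hI.comp (hg a) (ψ := fun x => ∏ r : s, g r (fun i => x ⟨i, hsub r i.2⟩))
      (by
        refine Finset.measurable_fun_prod _ fun r _ => (hg r).comp ?_
        fun_prop)
    rw [← ih (hJ.subset (by simp))]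
    have e : ∀ ω, ∏ r ∈ s, g r (fun i => ξ i ω) = ∏ r : s, g r (fun i => ξ i ω) := fun ω =>
      (Finset.prod_coe_sort s fun r => g r (fun i => ξ i ω)).symm
    simp_rw [e]
    exact lintegral_mul_eq_lintegral_mul_lintegral_of_indepFun'' (hmg a)
      (Finset.aemeasurable_fun_prod _ fun r _ => hmg r) hI'

section Concentration

variable {Ω ι R T : Type*} [MeasurableSpace Ω] {μ : Measure Ω} [Fintype R] [Fintype T]
  {ξ : ι → Ω → ℝ}

lemma hasSubgaussianMGF_linear_combination (hind : iIndepFun ξ μ)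
    (hsub : ∀ i, HasSubgaussianMGF (ξ i) 3 μ) {φ : T → ι} (hφ : Function.Injective φ)
    {x : T → ℝ} (hx : ∑ t, x t ^ 2 = 1) :
    HasSubgaussianMGF (fun ω => ∑ t, x t * ξ (φ t) ω) 3 μ := by
  have h1 : iIndepFun (fun t ω => x t * ξ (φ t) ω) μ :=
    (hind.precomp hφ).comp (fun t y => x t * y) fun t => measurable_const_mul _
  have h2 : ∀ t, HasSubgaussianMGF (fun ω => x t * ξ (φ t) ω) (Real.toNNReal (x t ^ 2) * 3) μ := by
    intro t
    rw [Real.toNNReal_of_nonneg (sq_nonneg (x t))]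
    exact (hsub (φ t)).const_mul (x t)
  have h3 := HasSubgaussianMGF.sum_of_iIndepFun h1 (s := Finset.univ) fun t _ => h2 t
  rwa [← Finset.sum_mul, ← Real.toNNReal_sum_of_nonneg fun t _ => sq_nonneg (x t), hx,
    Real.toNNReal_one, one_mul] at h3

lemma integral_sq_linear_combination (hind : iIndepFun ξ μ)
    (hsub : ∀ i, HasSubgaussianMGF (ξ i) 3 μ) (hmean : ∀ i, ∫ ω, ξ i ω ∂μ = 0)
    (hvar : ∀ i, ∫ ω, ξ i ω ^ 2 ∂μ = 1) {φ : T → ι} (hφ : Function.Injective φ)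
    {x : T → ℝ} (hx : ∑ t, x t ^ 2 = 1) :
    ∫ ω, (∑ t, x t * ξ (φ t) ω) ^ 2 ∂μ = 1 := by
  have := hind.isProbabilityMeasure
  have h1 : iIndepFun (fun t ω => x t * ξ (φ t) ω) μ :=
    (hind.precomp hφ).comp (fun t y => x t * y) fun t => measurable_const_mul _
  have hL : ∀ t, MemLp (fun ω => x t * ξ (φ t) ω) 2 μ := fun t =>
    ((hsub (φ t)).const_mul (x t)).memLp 2
  have hV := IndepFun.variance_sum (s := Finset.univ) (fun t _ => hL t)
    (fun s _ t _ hst => h1.indepFun hst)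
  have hmean' : ∫ ω, (∑ t, fun ω => x t * ξ (φ t) ω) ω ∂μ = 0 := by
    simp only [Finset.sum_apply]
    rw [integral_finsetSum _ fun t _ => (hL t).integrable (by norm_num)]
    simp [integral_const_mul, hmean]
  have hm : AEMeasurable (∑ t, fun ω => x t * ξ (φ t) ω) μ :=
    Finset.aemeasurable_sum _ fun t _ => (hL t).1.aemeasurable
  rw [variance_of_integral_eq_zero hm hmean'] at hV
  simp only [Finset.sum_apply] at hV
  rw [hV, ← hx]
  refine Finset.sum_congr rfl fun t _ => ?_
  rw [variance_const_mul, variance_of_integral_eq_zero (hsub _).aemeasurable (hmean _), hvar,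
    mul_one]

/-- Hölder's inequality over the colour classes of `f`: the moment generating function of the
centred squared norm is controlled although only rows of equal colour are independent. -/
lemma lintegral_exp_sum_sq_le (hind : iIndepFun ξ μ)
    (hsub : ∀ i, HasSubgaussianMGF (ξ i) 3 μ) (hmean : ∀ i, ∫ ω, ξ i ω ∂μ = 0)
    (hvar : ∀ i, ∫ ω, ξ i ω ^ 2 ∂μ = 1) {φ : R → T → ι} (hφ : ∀ r, Function.Injective (φ r))
    {q : ℕ} (hq : 0 < q) {f : R → Fin q}
    (hf : ∀ r r', r ≠ r' → f r = f r' → ∀ t t', φ r t ≠ φ r' t')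
    {x : T → ℝ} (hx : ∑ t, x t ^ 2 = 1) {θ : ℝ} (hθ : |θ| ≤ 1 / 24) :
    ∫⁻ ω, ENNReal.ofReal (Real.exp (θ / q * ∑ r, ((∑ t, x t * ξ (φ r t) ω) ^ 2 - 1))) ∂μ ≤
      ENNReal.ofReal (Real.exp (mgfSqConst * θ ^ 2 * Fintype.card R / q)) := by
  classical
  have := hind.isProbabilityMeasure
  have hm : ∀ i, AEMeasurable (ξ i) μ := fun i => (hsub i).aemeasurable
  have hq' : (q : ℝ) ≠ 0 := by positivity
  set W : R → Ω → ℝ≥0∞ := fun r ω =>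
    ENNReal.ofReal (Real.exp (θ * ((∑ t, x t * ξ (φ r t) ω) ^ 2 - 1))) with hW
  have hWm : ∀ r, AEMeasurable (W r) μ := fun r =>
    (((((Finset.aemeasurable_fun_sum _ fun t _ => (hm _).const_mul _).pow_const 2).sub_const
      1).const_mul θ).exp).ennreal_ofReal
  have hWle : ∀ r, ∫⁻ ω, W r ω ∂μ ≤ ENNReal.ofReal (Real.exp (mgfSqConst * θ ^ 2)) := fun r =>
    lintegral_exp_mul_sq_sub_one_le
      (hasSubgaussianMGF_linear_combination hind hsub (hφ r) hx)
      (integral_sq_linear_combination hind hsub hmean hvar (hφ r) hx) hθ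
  -- Rows of one colour involve disjoint sets of variables, so the expectation factors within a
  -- class.
  have hprod : ∀ c : Fin q, ∫⁻ ω, ∏ r with f r = c, W r ω ∂μ
      = ∏ r with f r = c, ∫⁻ ω, W r ω ∂μ := by
    intro c
    refine lintegral_prod_of_pairwiseDisjoint hind hm _
      (fun r => Finset.univ.image (φ r)) ?_
      (fun r y => ENNReal.ofReal (Real.exp (θ * ((∑ t, x t *
        y ⟨φ r t, Finset.mem_image_of_mem _ (Finset.mem_univ t)⟩) ^ 2 - 1)))) ?_
    · intro r hr r' hr' hne
      simp only [Finset.coe_filter, Finset.mem_univ, true_and, Set.mem_ofPred_eq] at hr hr'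
      rw [Function.onFun, Finset.disjoint_left]
      intro i hi hi'
      obtain ⟨t, -, rfl⟩ := Finset.mem_image.1 hi
      obtain ⟨t', -, h⟩ := Finset.mem_image.1 hi'
      exact hf r r' hne (hr.trans hr'.symm) t t' h.symm
    · intro r
      fun_prop
  -- One factor per colour with exponent `1/q`; these weights sum to 1, as Hölder requires.
  have hsplit : ∀ ω, ENNReal.ofReal (Real.exp (θ / q *
      ∑ r, ((∑ t, x t * ξ (φ r t) ω) ^ 2 - 1))) =
      ∏ c : Fin q, (∏ r with f r = c, W r ω) ^ (1 / (q : ℝ)) := by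
    intro ω
    rw [ENNReal.prod_rpow_of_nonneg (by positivity),
      Finset.prod_fiberwise (s := Finset.univ) (g := f) (f := fun r => W r ω)]
    simp only [hW]
    rw [← ENNReal.ofReal_prod_of_nonneg fun r _ => (Real.exp_pos _).le, ← Real.exp_sum,
      ENNReal.ofReal_rpow_of_pos (Real.exp_pos _), ← Real.exp_mul, ← Finset.mul_sum]
    congr 2
    ring
  calc _ = ∫⁻ ω, ∏ c : Fin q, (∏ r with f r = c, W r ω) ^ (1 / (q : ℝ)) ∂μ :=
        lintegral_congr hsplit
    _ ≤ ∏ c : Fin q, (∫⁻ ω, ∏ r with f r = c, W r ω ∂μ) ^ (1 / (q : ℝ)) :=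
        ENNReal.lintegral_prod_norm_pow_le _
          (fun c _ => Finset.aemeasurable_fun_prod _ fun r _ => hWm r)
          (by simp [hq']) fun c _ => by positivity
    _ = ∏ c : Fin q, (∏ r with f r = c, ∫⁻ ω, W r ω ∂μ) ^ (1 / (q : ℝ)) := by
        simp_rw [hprod]
    _ = (∏ r, ∫⁻ ω, W r ω ∂μ) ^ (1 / (q : ℝ)) := by
        rw [ENNReal.prod_rpow_of_nonneg (by positivity),
          Finset.prod_fiberwise (s := Finset.univ) (g := f) (f := fun r => ∫⁻ ω, W r ω ∂μ)]
    _ ≤ (∏ _r : R, ENNReal.ofReal (Real.exp (mgfSqConst * θ ^ 2))) ^ (1 / (q : ℝ)) := by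
        gcongr with r; exact hWle r
    _ = _ := by
        rw [Finset.prod_const, ← ENNReal.ofReal_pow (Real.exp_pos _).le, ← Real.exp_nat_mul,
          ENNReal.ofReal_rpow_of_pos (Real.exp_pos _), ← Real.exp_mul, Finset.card_univ]
        congr 2
        ring

lemma measure_sum_sq_deviation_le (hind : iIndepFun ξ μ)
    (hsub : ∀ i, HasSubgaussianMGF (ξ i) 3 μ) (hmean : ∀ i, ∫ ω, ξ i ω ∂μ = 0)
    (hvar : ∀ i, ∫ ω, ξ i ω ^ 2 ∂μ = 1) {φ : R → T → ι} (hφ : ∀ r, Function.Injective (φ r))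
    {q : ℕ} (hq : 0 < q) {f : R → Fin q}
    (hf : ∀ r r', r ≠ r' → f r = f r' → ∀ t t', φ r t ≠ φ r' t')
    {x : T → ℝ} (hx : ∑ t, x t ^ 2 = 1) {η : ℝ} (hη0 : 0 < η) (hη1 : η ≤ 1) :
    μ {ω | η * Fintype.card R ≤
        |∑ r, (∑ t, x t * ξ (φ r t) ω) ^ 2 - Fintype.card R|} ≤
      ENNReal.ofReal (2 * Real.exp (-(η ^ 2 / (4 * mgfSqConst)) * Fintype.card R / q)) := by
  have hC := le_mgfSqConst
  have hC0 : 0 < mgfSqConst := by linarith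
  have hq' : (0 : ℝ) < q := by positivity
  set n : ℝ := (Fintype.card R : ℝ) with hn
  -- This minimises the Chernoff exponent `(C θ² - η θ) n / q`, with minimum `-η² n / (4 C q)`.
  set θ : ℝ := η / (2 * mgfSqConst) with hθ
  have hθ0 : 0 < θ := by positivity
  have hθ1 : θ ≤ 1 / 24 := by
    rw [hθ, div_le_div_iff₀ (by positivity) (by norm_num)]
    linarith
  set D : Ω → ℝ := fun ω => ∑ r, ((∑ t, x t * ξ (φ r t) ω) ^ 2 - 1) with hD
  have hDeq : ∀ ω, ∑ r, (∑ t, x t * ξ (φ r t) ω) ^ 2 - n = D ω := fun ω => by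
    simp [hD, Finset.sum_sub_distrib, hn]
  have hDm : AEMeasurable D μ := by
    have hm : ∀ i, AEMeasurable (ξ i) μ := fun i => (hsub i).aemeasurable
    exact Finset.aemeasurable_fun_sum _ fun r _ =>
      ((Finset.aemeasurable_fun_sum _ fun t _ => (hm _).const_mul _).pow_const 2).sub_const 1
  have tail : ∀ σ : ℝ, |σ| = 1 → μ {ω | η * n ≤ σ * D ω} ≤
      ENNReal.ofReal (Real.exp (-(η ^ 2 / (4 * mgfSqConst)) * n / q)) := by
    intro σ hσ
    have hσ2 : σ ^ 2 = 1 := by rw [← sq_abs, hσ]; norm_num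
    have hmgf := lintegral_exp_sum_sq_le hind hsub hmean hvar hφ hq hf hx (θ := σ * θ)
      (by rw [abs_mul, hσ, one_mul, abs_of_pos hθ0]; exact hθ1)
    have hmk := mul_meas_ge_le_lintegral₀ (μ := μ)
      (f := fun ω => ENNReal.ofReal (Real.exp (σ * θ / q * D ω)))
      ((hDm.const_mul _).exp.ennreal_ofReal) (ENNReal.ofReal (Real.exp (θ / q * (η * n))))
    have hsubset : {ω | η * n ≤ σ * D ω} ⊆ {ω | ENNReal.ofReal (Real.exp (θ / q * (η * n))) ≤
        ENNReal.ofReal (Real.exp (σ * θ / q * D ω))} := by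
      intro ω hω
      refine ENNReal.ofReal_le_ofReal (Real.exp_le_exp.2 ?_)
      calc θ / q * (η * n) ≤ θ / q * (σ * D ω) :=
            mul_le_mul_of_nonneg_left hω (by positivity)
        _ = _ := by ring
    have hle := ((mul_le_mul_right (measure_mono hsubset) _).trans hmk).trans hmgf
    rw [mul_comm, ← ENNReal.le_div_iff_mul_le
      (Or.inl (by simp [Real.exp_pos])) (Or.inl ENNReal.ofReal_ne_top),
      ← ENNReal.ofReal_div_of_pos (Real.exp_pos _), ← Real.exp_sub] at hle
    refine hle.trans_eq ?_
    congr 2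
    rw [mul_pow, hσ2, hθ]
    field_simp
    ring
  have hsub2 : {ω | η * n ≤ |∑ r, (∑ t, x t * ξ (φ r t) ω) ^ 2 - n|} ⊆
      {ω | η * n ≤ 1 * D ω} ∪ {ω | η * n ≤ (-1) * D ω} := by
    intro ω hω
    simp only [Set.mem_ofPred_eq, hDeq] at hω
    rcases le_abs.1 hω with h | h
    · left; simpa using h
    · right; simpa using h
  refine (measure_mono hsub2).trans ((measure_union_le _ _).trans ?_)
  rw [two_mul, ENNReal.ofReal_add (Real.exp_pos _).le (Real.exp_pos _).le]
  exact add_le_add (tail 1 (by simp)) (tail (-1) (by simp))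

end Concentration

/-! ### Nets of the unit ball -/

section Net

variable {E : Type*} [NormedAddCommGroup E] [NormedSpace ℝ E] [FiniteDimensional ℝ E]

open Metric Module in
-- Volume comparison: the balls of radius `ε/2` about the points are disjoint and lie in the ball of
-- radius `1 + ε/2`.
lemma card_le_of_separated_of_norm_le_one {ε : ℝ} (hε : 0 < ε) (s : Finset E)
    (hs : ∀ c ∈ s, ‖c‖ ≤ 1) (h : ∀ c ∈ s, ∀ d ∈ s, c ≠ d → ε ≤ ‖c - d‖) :
    (s.card : ℝ) ≤ (1 + 2 / ε) ^ finrank ℝ E := by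
  borelize E
  let μ : Measure E := Measure.addHaar
  have hr : 0 < ε / 2 := by positivity
  have hρ : 0 < 1 + ε / 2 := by positivity
  have hdisj : (s : Set E).PairwiseDisjoint fun c => ball c (ε / 2) := by
    intro c hc d hd hcd
    apply ball_disjoint_ball
    rw [dist_eq_norm]
    linarith [h c hc d hd hcd]
  have hsub : (⋃ c ∈ s, ball c (ε / 2)) ⊆ ball (0 : E) (1 + ε / 2) := by
    refine Set.iUnion₂_subset fun x hx => ball_subset_ball' ?_
    rw [dist_zero_right]
    linarith [hs x hx]
  have hvol : (s.card : ℝ≥0∞) * ENNReal.ofReal ((ε / 2) ^ finrank ℝ E) * μ (ball 0 1) ≤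
      ENNReal.ofReal ((1 + ε / 2) ^ finrank ℝ E) * μ (ball 0 1) := by
    calc _ = μ (⋃ c ∈ s, ball c (ε / 2)) := by
          rw [measure_biUnion_finset hdisj fun c _ => measurableSet_ball]
          simp only [μ.addHaar_ball_of_pos _ hr, Finset.sum_const, nsmul_eq_mul, mul_assoc]
      _ ≤ μ (ball (0 : E) (1 + ε / 2)) := measure_mono hsub
      _ = _ := by rw [μ.addHaar_ball_of_pos _ hρ]
  have hvol' := (ENNReal.mul_le_mul_iff_left
    (measure_ball_pos μ _ zero_lt_one).ne' measure_ball_lt_top.ne).1 hvol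
  have hreal := ENNReal.toReal_le_of_le_ofReal (by positivity) hvol'
  rw [ENNReal.toReal_mul, ENNReal.toReal_natCast, ENNReal.toReal_ofReal (by positivity),
    ← le_div_iff₀ (by positivity), ← div_pow] at hreal
  refine hreal.trans_eq ?_
  congr 1
  field_simp
  ring

/-- A separated set of maximal cardinality is a net, since a point far from it could be added; the
packing bound ensures that a maximum exists. -/
lemma exists_finset_net {ε : ℝ} (hε : 0 < ε) :
    ∃ s : Finset E, (s.card : ℝ) ≤ (1 + 2 / ε) ^ Module.finrank ℝ E ∧ (∀ v ∈ s, ‖v‖ ≤ 1) ∧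
      ∀ x : E, ‖x‖ ≤ 1 → ∃ v ∈ s, ‖x - v‖ ≤ ε := by
  classical
  let S : Set ℕ := {n | ∃ s : Finset E, s.card = n ∧ (∀ c ∈ s, ‖c‖ ≤ 1) ∧
    ∀ c ∈ s, ∀ d ∈ s, c ≠ d → ε ≤ ‖c - d‖}
  have hne : S.Nonempty := ⟨0, ∅, by simp⟩
  have hbdd : BddAbove S := by
    refine ⟨⌈(1 + 2 / ε) ^ Module.finrank ℝ E⌉₊, ?_⟩
    rintro n ⟨s, rfl, h1, h2⟩
    exact Nat.cast_le.1
      ((card_le_of_separated_of_norm_le_one hε s h1 h2).trans (Nat.le_ceil _))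
  obtain ⟨s, hcard, h1, h2⟩ := Nat.sSup_mem hne hbdd
  refine ⟨s, card_le_of_separated_of_norm_le_one hε s h1 h2, h1, fun x hx => ?_⟩
  by_contra! hcon
  have hxs : x ∉ s := fun hxs => by
    have := hcon x hxs
    simp at this
    linarith
  have hmem : s.card + 1 ∈ S := by
    refine ⟨insert x s, Finset.card_insert_of_notMem hxs, ?_, ?_⟩
    · intro c hc
      rcases Finset.mem_insert.1 hc with rfl | hc
      · exact hx
      · exact h1 c hc
    · intro c hc d hd hcd
      rcases Finset.mem_insert.1 hc with rfl | hc₁ <;>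
        rcases Finset.mem_insert.1 hd with rfl | hd₁
      · exact absurd rfl hcd
      · exact (hcon d hd₁).le
      · rw [norm_sub_rev]; exact (hcon c hc₁).le
      · exact h2 c hc₁ d hd₁ hcd
  have := le_csSup hbdd hmem
  omega

variable {F : Type*} [NormedAddCommGroup F] [NormedSpace ℝ F]

/-- A linear map that almost preserves the norm on a fine net of the unit ball almost preserves it
everywhere. -/
lemma near_isometry_of_net {δ : ℝ} (hδ0 : 0 < δ) (hδ1 : δ < 1) {s : Finset E}
    (hs1 : ∀ v ∈ s, ‖v‖ ≤ 1) (hs2 : ∀ x : E, ‖x‖ ≤ 1 → ∃ v ∈ s, ‖x - v‖ ≤ δ / 8)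
    (L : E →ₗ[ℝ] F) (hL : ∀ v ∈ s, |‖L v‖ ^ 2 - ‖v‖ ^ 2| ≤ δ / 8 * ‖v‖ ^ 2) (z : E) :
    (1 - δ) * ‖z‖ ^ 2 ≤ ‖L z‖ ^ 2 ∧ ‖L z‖ ^ 2 ≤ (1 + δ) * ‖z‖ ^ 2 := by
  set η := δ / 8 with hη
  have hη0 : 0 < η := by positivity
  have hη1 : η ≤ 1 / 8 := by rw [hη]; linarith
  have hup : ∀ v ∈ s, ‖L v‖ ≤ (1 + η) * ‖v‖ := fun v hv => by
    have h := (abs_le.1 (hL v hv)).2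
    refine abs_le_of_sq_le_sq' ?_ (by positivity) |>.2
    nlinarith [sq_nonneg ‖v‖, mul_nonneg hη0.le (sq_nonneg ‖v‖)]
  have hlow : ∀ v ∈ s, (1 - η) * ‖v‖ ≤ ‖L v‖ := fun v hv => by
    have h := (abs_le.1 (hL v hv)).1
    refine abs_le_of_sq_le_sq' ?_ (by positivity) |>.2
    nlinarith [sq_nonneg ‖v‖, mul_nonneg hη0.le (sq_nonneg ‖v‖)]
  set K := ‖LinearMap.toContinuousLinearMap L‖ with hK
  have hKL : ∀ x, ‖L x‖ ≤ K * ‖x‖ := (LinearMap.toContinuousLinearMap L).le_opNorm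
  have hK0 : 0 ≤ K := norm_nonneg _
  -- Split `L x = L v + L (x - v)` with `v` in the net; `‖v‖ ≥ 1 - η` produces the square in the
  -- lower bound.
  have hunit : ∀ x : E, ‖x‖ = 1 → ‖L x‖ ≤ (1 + η) + K * η ∧ (1 - η) ^ 2 - K * η ≤ ‖L x‖ := by
    intro x hx
    obtain ⟨v, hv, hxv⟩ := hs2 x hx.le
    have e : L x = L v + L (x - v) := by rw [← map_add]; congr 1; abel
    have h1 : ‖L (x - v)‖ ≤ K * η := (hKL _).trans (by gcongr)
    have h2 := hup v hv
    have h3 := hlow v hv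
    have h4 := hs1 v hv
    have h5 : 1 - η ≤ ‖v‖ := by
      have := norm_sub_norm_le x v
      linarith
    constructor
    · rw [e]
      refine (norm_add_le _ _).trans (add_le_add (h2.trans ?_) h1)
      nlinarith
    · have h6 : ‖L v‖ - ‖L (x - v)‖ ≤ ‖L x‖ := by
        rw [e]; have := norm_sub_le (L v + L (x - v)) (L (x - v))
        rw [add_sub_cancel_right] at this; linarith
      nlinarith
  have hscale : ∀ x : E, x ≠ 0 → ‖(‖x‖⁻¹ : ℝ) • x‖ = 1 ∧
      ‖L x‖ = ‖x‖ * ‖L ((‖x‖⁻¹ : ℝ) • x)‖ := by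
    intro x hx
    have hx' : ‖x‖ ≠ 0 := norm_ne_zero_iff.2 hx
    constructor
    · rw [norm_smul, norm_inv, norm_norm, inv_mul_cancel₀ hx']
    · rw [map_smul, norm_smul, norm_inv, norm_norm, ← mul_assoc, mul_inv_cancel₀ hx', one_mul]
  -- The operator norm bounds itself: `K (1 - η) ≤ 1 + η`, which determines the upper estimate.
  have hKle : K ≤ (1 + η) + K * η := by
    refine ContinuousLinearMap.opNorm_le_bound _ (by positivity) fun x => ?_
    by_cases hx : x = 0
    · simp [hx]
    · obtain ⟨h1, h2⟩ := hscale x hx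
      change ‖L x‖ ≤ _
      rw [h2, mul_comm]
      gcongr
      exact (hunit _ h1).1
  have hK2 : K ^ 2 ≤ 1 + δ := by
    have h1 : K * (1 - η) ≤ 1 + η := by linarith
    have h2 : (K * (1 - η)) ^ 2 ≤ (1 + η) ^ 2 :=
      pow_le_pow_left₀ (mul_nonneg hK0 (by linarith)) h1 2
    have h3 : (1 + η) ^ 2 ≤ (1 + δ) * (1 - η) ^ 2 := by
      have : δ = 8 * η := by rw [hη]; ring
      rw [this]
      nlinarith [mul_pos hη0 hη0, mul_nonneg hη0.le (sub_nonneg.2 hη1)]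
    have h4 : 0 < (1 - η) ^ 2 := pow_pos (by linarith) 2
    rw [mul_pow] at h2
    exact le_of_mul_le_mul_right (h2.trans h3) h4
  have hK3 : K ≤ 9 / 7 := by
    nlinarith
  by_cases hz : z = 0
  · simp [hz]
  obtain ⟨h1, h2⟩ := hscale z hz
  obtain ⟨-, h4⟩ := hunit _ h1
  constructor
  · rw [h2, mul_pow, mul_comm]
    gcongr
    -- From `K ≤ 9/7`, `(1 - η)² - K η ≥ 1 - 4η`; squaring gives at least `1 - 8η = 1 - δ`.
    have h5 : 1 - 4 * η ≤ ‖L ((‖z‖⁻¹ : ℝ) • z)‖ := by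
      refine le_trans ?_ h4
      nlinarith
    have h6 : (1 - 4 * η) ^ 2 ≤ ‖L ((‖z‖⁻¹ : ℝ) • z)‖ ^ 2 :=
      pow_le_pow_left₀ (by linarith) h5 2
    refine le_trans ?_ h6
    have : δ = 8 * η := by rw [hη]; ring
    rw [this]
    nlinarith
  · calc ‖L z‖ ^ 2 ≤ (K * ‖z‖) ^ 2 := by gcongr; exact hKL z
      _ = K ^ 2 * ‖z‖ ^ 2 := by ring
      _ ≤ _ := by gcongr

end Net

/-- It suffices to check the restricted isometry property on supports of maximal size. -/
lemma satisfiesRIP_of_card_eq {ι κ : Type*} [Fintype ι] [Fintype κ] {A : Matrix ι κ ℝ} {s : ℕ}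
    {δ : ℝ} (hs : s ≤ Fintype.card κ)
    (h : ∀ T : Finset κ, T.card = s → ∀ z : EuclideanSpace ℝ T,
      (1 - δ) * ‖z‖ ^ 2 ≤
        ‖WithLp.toLp 2 ((A.submatrix id (fun t : T => (t : κ))).mulVec z.ofLp)‖ ^ 2 ∧
      ‖WithLp.toLp 2 ((A.submatrix id (fun t : T => (t : κ))).mulVec z.ofLp)‖ ^ 2 ≤
        (1 + δ) * ‖z‖ ^ 2) :
    SatisfiesRIP A s δ := by
  classical
  intro T hT z
  obtain ⟨T', hTT', hT'⟩ := Finset.exists_superset_card_eq hT hs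
  -- Extending `z` by zero to the larger support changes neither its norm nor its image.
  let y : κ → ℝ := fun t => if h : t ∈ T then z ⟨t, h⟩ else 0
  have hyT : ∀ t : T, y t = z t := fun t => by simp [y]
  have hsum : ∀ g : κ → ℝ, (∀ t, t ∉ T → g t = 0) → ∑ t : T', g t = ∑ t : T, g t := by
    intro g hg
    rw [Finset.sum_coe_sort T' g, Finset.sum_coe_sort T g]
    exact (Finset.sum_subset hTT' fun t _ ht => hg t ht).symm
  have hy0 : ∀ t, t ∉ T → y t = 0 := fun t ht => by simp [y, ht]
  have key := h T' hT' (WithLp.toLp 2 fun t => y t)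
  have e1 : ‖(WithLp.toLp 2 fun t : T' => y t : EuclideanSpace ℝ T')‖ ^ 2 = ‖z‖ ^ 2 := by
    rw [EuclideanSpace.real_norm_sq_eq, EuclideanSpace.real_norm_sq_eq]
    refine (hsum (fun t => y t ^ 2) fun t ht => by simp [hy0 t ht]).trans ?_
    simp only [hyT]
  have e2 : (A.submatrix id (fun t : T' => (t : κ))).mulVec (fun t => y t) =
      (A.submatrix id (fun t : T => (t : κ))).mulVec z.ofLp := by
    funext i
    simp only [Matrix.mulVec, dotProduct, Matrix.submatrix_apply, id]
    refine (hsum (fun t => A i t * y t) fun t ht => by simp [hy0 t ht]).trans ?_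
    simp only [hyT]
  simp only [e1, e2] at key
  exact key

/-! ### The three entry laws -/

section Law

variable {Ω : Type*} [MeasurableSpace Ω] {μ : Measure Ω}

lemma integral_bernoulli_law (n : ℕ) (g : ℝ → ℝ) :
    ∫ x, g x ∂(EntryDistribution.bernoulli.law n) =
      1 / 2 * g (1 / √(n : ℝ)) + 1 / 2 * g (-(1 / √(n : ℝ))) := by
  have hi : ∀ a : ℝ, Integrable g ((1 / 2 : ℝ≥0∞) • Measure.dirac a) := fun a =>
    (integrable_dirac (by simp)).smul_measure (by simp)
  rw [EntryDistribution.law, integral_add_measure (hi _) (hi _)]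
  simp [integral_smul_measure]

lemma integral_ternary_law (n : ℕ) (g : ℝ → ℝ) :
    ∫ x, g x ∂(EntryDistribution.ternary.law n) =
      1 / 6 * g (√(3 / (n : ℝ))) + 2 / 3 * g 0 + 1 / 6 * g (-√(3 / (n : ℝ))) := by
  have hi : ∀ (a : ℝ) (c : ℝ≥0∞), c ≠ ∞ → Integrable g (c • Measure.dirac a) := fun a c hc =>
    (integrable_dirac (by simp)).smul_measure hc
  have h6 : (1 / 6 : ℝ≥0∞) ≠ ∞ := by simp
  have h3 : (2 / 3 : ℝ≥0∞) ≠ ∞ := ENNReal.div_ne_top (by simp) (by simp)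
  rw [EntryDistribution.law, integral_add_measure ((hi _ _ h6).add_measure (hi _ _ h3))
    (hi _ _ h6), integral_add_measure (hi _ _ h6) (hi _ _ h3)]
  simp [integral_smul_measure]

/-- The properties of the normalised entries that the concentration argument uses. -/
lemma normalized_entry_properties [IsProbabilityMeasure μ] (P : EntryDistribution) {n : ℕ}
    (hn : 0 < n) {X : Ω → ℝ} (hX : HasLaw X (P.law n) μ) :
    HasSubgaussianMGF (fun ω => √n * X ω) 3 μ ∧ ∫ ω, √n * X ω ∂μ = 0 ∧
      ∫ ω, (√n * X ω) ^ 2 ∂μ = 1 := by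
  have hn' : (0 : ℝ) < n := by positivity
  have hsn : √(n : ℝ) ^ 2 = n := Real.sq_sqrt hn'.le
  have hs0 : 0 < √(n : ℝ) := Real.sqrt_pos.2 hn'
  have h3 : √(3 / (n : ℝ)) = √3 / √n := Real.sqrt_div (by norm_num) _
  have hs3 : √(3 : ℝ) ^ 2 = 3 := Real.sq_sqrt (by norm_num)
  have h13 : (1 : ℝ) ≤ √3 := Real.one_le_sqrt.2 (by norm_num)
  have hXm := hX.aemeasurable
  have e1 : ∫ ω, √n * X ω ∂μ = ∫ x, √n * x ∂(P.law n) :=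
    hX.integral_comp (f := fun x => √n * x) (by fun_prop)
  have e2 : ∫ ω, (√n * X ω) ^ 2 ∂μ = ∫ x, (√n * x) ^ 2 ∂(P.law n) :=
    hX.integral_comp (f := fun x => (√n * x) ^ 2) (by fun_prop)
  -- Both discrete laws, once normalised, live on `[-√3, √3]`, where Hoeffding's lemma gives
  -- parameter `(2√3/2)² = 3`. The Gaussian has parameter 1, so 3 serves all three.
  have bdd : (∀ᵐ x ∂(P.law n), √n * x ∈ Set.Icc (-√3) (√3)) → ∫ ω, √n * X ω ∂μ = 0 →
      HasSubgaussianMGF (fun ω => √n * X ω) 3 μ := by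
    intro hb h0
    have hb' : ∀ᵐ ω ∂μ, √n * X ω ∈ Set.Icc (-√3) (√3) :=
      (hX.ae_iff (p := fun x => √n * x ∈ Set.Icc (-√3) (√3))
        (measurableSet_Icc.mem.comp (by fun_prop))).2 hb
    have h := hasSubgaussianMGF_of_mem_Icc_of_integral_eq_zero (hXm.const_mul _) hb' h0
    convert h using 1
    apply NNReal.eq
    push_cast
    rw [Real.norm_of_nonneg (by linarith)]
    linarith
  cases P with
  | gaussian =>
    simp only [EntryDistribution.law] at hX e1 e2
    have hmean : ∫ ω, X ω ∂μ = 0 := by rw [hX.integral_eq, integral_id_gaussianReal]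
    have hv : ∫ ω, X ω ^ 2 ∂μ = 1 / n := by
      rw [← variance_of_integral_eq_zero hXm hmean, hX.variance_eq, variance_id_gaussianReal]
      simp
    refine ⟨⟨fun t => ?_, fun t => ?_⟩, ?_, ?_⟩
    · have h := integrable_exp_mul_gaussianReal (μ := 0) (v := 1 / (n : ℝ≥0)) (t * √n)
      rw [← hX.map_eq] at h
      have h' := h.comp_aemeasurable hXm
      refine h'.congr (ae_of_all _ fun ω => ?_)
      simp [mul_assoc]
    · rw [mgf_const_mul, mgf_gaussianReal hX.map_eq, Real.exp_le_exp]
      push_cast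
      rw [mul_pow, hsn]
      field_simp
      nlinarith [sq_nonneg t]
    · rw [integral_const_mul, hmean, mul_zero]
    · simp_rw [mul_pow, hsn]
      rw [integral_const_mul, hv]
      field_simp
  | bernoulli =>
    have h0 : ∫ ω, √n * X ω ∂μ = 0 := by
      rw [e1, integral_bernoulli_law]; ring
    refine ⟨bdd ?_ h0, h0, ?_⟩
    · simp only [EntryDistribution.law, ae_add_measure_iff]
      refine ⟨Measure.ae_smul_measure ?_ _, Measure.ae_smul_measure ?_ _⟩ <;>
      · rw [ae_dirac_eq]
        simp only [Filter.eventually_pure, Set.mem_Icc, mul_neg, mul_one_div_cancel hs0.ne']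
        constructor <;> linarith
    · rw [e2, integral_bernoulli_law]
      field_simp
      norm_num
  | ternary =>
    have h0 : ∫ ω, √n * X ω ∂μ = 0 := by
      rw [e1, integral_ternary_law]; ring
    refine ⟨bdd ?_ h0, h0, ?_⟩
    · simp only [EntryDistribution.law, ae_add_measure_iff]
      refine ⟨⟨Measure.ae_smul_measure ?_ _, Measure.ae_smul_measure ?_ _⟩,
        Measure.ae_smul_measure ?_ _⟩ <;>
      · rw [ae_dirac_eq]
        simp only [Filter.eventually_pure, Set.mem_Icc, mul_neg, h3, mul_div_cancel₀ _ hs0.ne',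
          mul_zero]
        constructor <;> linarith
    · rw [e2, integral_ternary_law, h3]
      field_simp
      rw [hs3]
      norm_num

end Law

/-! ### Colouring the block rows -/

section Coloring

/-- Colour in increasing order: at most `D` earlier neighbours block at most `D` of the `D + 1`
colours. -/
lemma exists_greedy_coloring (adj : ℕ → ℕ → Prop) [DecidableRel adj] {D : ℕ}
    (h : ∀ i, ((Finset.range i).filter fun j => adj j i).card ≤ D) (l : ℕ) :
    ∃ f : ℕ → Fin (D + 1), ∀ i j, j < i → i < l → adj j i → f j ≠ f i := by
  induction l with
  | zero => exact ⟨fun _ => 0, fun i j _ hi => by omega⟩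
  | succ l ih =>
    obtain ⟨f, hf⟩ := ih
    obtain ⟨c, -, hc⟩ := Finset.exists_mem_notMem_of_card_lt_card
      (s := ((Finset.range l).filter fun j => adj j l).image f) (t := Finset.univ)
      (by
        rw [Finset.card_univ, Fintype.card_fin]
        exact Nat.lt_succ_of_le (Finset.card_image_le.trans (h l)))
    refine ⟨Function.update f l c, fun i j hji hi hadj => ?_⟩
    rcases Nat.lt_succ_iff_lt_or_eq.1 hi with hi' | rfl
    · rw [Function.update_of_ne (by omega), Function.update_of_ne (by omega)]
      exact hf i j hji hi' hadj
    · rw [Function.update_of_ne (by omega), Function.update_self]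
      rintro rfl
      exact hc (Finset.mem_image_of_mem f (by simp [hji, hadj]))

/-- Block rows of equal colour use different blocks in the columns indexed by `T`. -/
def IsBlockRowColoring {k l e q : ℕ} (T : Finset (Fin k × Fin e)) (f : Fin l → Fin q) : Prop :=
  ∀ i j : Fin l, i ≠ j → f i = f j → ∀ t ∈ T, ∀ t' ∈ T,
    (i : ℕ) + (k - 1 - t.1) ≠ (j : ℕ) + (k - 1 - t'.1)

lemma isBlockRowColoring_id {k l e : ℕ} (T : Finset (Fin k × Fin e)) :
    IsBlockRowColoring T (id : Fin l → Fin l) :=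
  fun _ _ hij h => absurd h hij

/-- A conflict of `i` with an earlier `j` comes from an ordered pair `(t, t')` in `T`, and `i` with
the pair determines `j`. Equal entries would force `j = i`, so at most `|T|(|T|-1)` earlier rows
conflict with `i`. -/
lemma exists_isBlockRowColoring {k e : ℕ} (l : ℕ) (T : Finset (Fin k × Fin e)) :
    ∃ f : Fin l → Fin (T.card * (T.card - 1) + 1), IsBlockRowColoring T f := by
  classical
  let adj : ℕ → ℕ → Prop := fun j i =>
    ∃ t ∈ T, ∃ t' ∈ T, i + (k - 1 - t.1) = j + (k - 1 - t'.1)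
  obtain ⟨f, hf⟩ := exists_greedy_coloring adj (D := T.card * (T.card - 1)) (fun i => by
    rw [Nat.mul_sub_one, ← Finset.offDiag_card]
    refine le_trans (Finset.card_le_card (t := T.offDiag.image
      fun p => i + (k - 1 - p.1.1) - (k - 1 - p.2.1)) ?_) Finset.card_image_le
    intro j hj
    obtain ⟨hji, t, ht, t', ht', h⟩ := Finset.mem_filter.1 hj
    rw [Finset.mem_range] at hji
    refine Finset.mem_image.2 ⟨(t, t'), Finset.mem_offDiag.2 ⟨ht, ht', ?_⟩, ?_⟩
    · intro htt
      simp only at htt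
      subst htt
      omega
    · simp only
      omega) l
  refine ⟨fun i => f i, fun i j hij hfij t ht t' ht' h => ?_⟩
  rcases lt_or_gt_of_ne (Fin.val_ne_of_ne hij) with hlt | hlt
  · exact hf j i hlt j.2 ⟨t', ht', t, ht, h.symm⟩ hfij
  · exact hf i j hlt i.2 ⟨t, ht, t', ht', h⟩ hfij.symm

end Coloring

/-- Since `e < 3`, `(3m)! ≥ (3m/e)^(3m) ≥ m^(3m)`. -/
lemma choose_three_mul_le {N m : ℕ} (hm : 1 ≤ m) (hN : 3 * m ≤ N) :
    (N.choose (3 * m) : ℝ) ≤ Real.exp (3 * m * Real.log ((N : ℝ) / m)) := by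
  have hm' : (0 : ℝ) < m := by positivity
  have hN' : (0 : ℝ) < N := by
    have : 0 < N := by omega
    positivity
  have h1 : (N.choose (3 * m) : ℝ) ≤ (N : ℝ) ^ (3 * m) / (3 * m).factorial :=
    Nat.choose_le_pow_div _ _
  have h2 : ((3 * m : ℕ) : ℝ) ^ (3 * m) / (3 * m).factorial ≤ Real.exp (3 * m : ℕ) :=
    Real.pow_div_factorial_le_exp _ (by positivity) _
  have h3 : Real.exp (3 * m : ℕ) ≤ (3 : ℝ) ^ (3 * m) := by
    rw [← mul_one ((3 * m : ℕ) : ℝ), Real.exp_nat_mul]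
    gcongr
    exact Real.exp_one_lt_three.le
  have h4 : Real.exp (3 * m * Real.log ((N : ℝ) / m)) = ((N : ℝ) / m) ^ (3 * m) := by
    rw [← Real.exp_log (show 0 < (N : ℝ) / m by positivity), ← Real.exp_nat_mul, Real.log_exp]
    push_cast
    rfl
  have hf : (0 : ℝ) < (3 * m).factorial := by positivity
  have h5 : (m : ℝ) ^ (3 * m) ≤ (3 * m).factorial := by
    have h6 := h2.trans h3
    rw [div_le_iff₀ hf] at h6
    push_cast at h6
    rw [mul_pow] at h6
    exact le_of_mul_le_mul_left h6 (by positivity)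
  rw [h4, div_pow]
  exact h1.trans (by gcongr)

/-! ### Deviation and union bounds for the Toeplitz block matrix -/

section Toeplitz

variable {k l d e : ℕ}

/-- The index of the variable in row `p` and column `t` of the Toeplitz block matrix. -/
def toeplitzIndex (p : Fin l × Fin d) (t : Fin k × Fin e) :
    Fin (k + l - 1) × Fin d × Fin e :=
  (⟨p.1 + (k - 1 - t.1), by have := p.1.isLt; have := t.1.isLt; omega⟩, p.2, t.2)

lemma toeplitzIndex_injective (p : Fin l × Fin d) :
    Function.Injective (toeplitzIndex p : Fin k × Fin e → _) := by
  rintro ⟨j, b⟩ ⟨j', b'⟩ h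
  simp only [toeplitzIndex, Prod.mk.injEq, Fin.mk.injEq, true_and] at h
  have := j.isLt
  have := j'.isLt
  exact Prod.ext (Fin.ext (by simp only; omega)) h.2

/-- Within one block row, distinct rows differ in their position inside the block; across block rows
the colouring separates the blocks. -/
lemma toeplitzIndex_ne {q : ℕ} {T : Finset (Fin k × Fin e)} {f : Fin l → Fin q}
    (hf : IsBlockRowColoring T f) {p p' : Fin l × Fin d} (hp : p ≠ p') (hfp : f p.1 = f p'.1)
    {t t' : Fin k × Fin e} (ht : t ∈ T) (ht' : t' ∈ T) :
    toeplitzIndex p t ≠ toeplitzIndex p' t' := by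
  intro h
  simp only [toeplitzIndex, Prod.mk.injEq, Fin.mk.injEq] at h
  by_cases h1 : p.1 = p'.1
  · exact hp (Prod.ext h1 h.2.1)
  · exact hf _ _ h1 hfp t ht t' ht' h.1

/-- The columns with index in `T` of the Toeplitz block matrix, as a linear map. -/
noncomputable def toeplitzColumns (T : Finset (Fin k × Fin e))
    (B : Fin (k + l - 1) → Matrix (Fin d) (Fin e) ℝ) :
    EuclideanSpace ℝ T →ₗ[ℝ] EuclideanSpace ℝ (Fin l × Fin d) :=
  (WithLp.linearEquiv 2 ℝ (Fin l × Fin d → ℝ)).symm.toLinearMap ∘ₗ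
    ((toeplitzBlock B).submatrix id (fun t : T => (t : Fin k × Fin e))).mulVecLin ∘ₗ
      (WithLp.linearEquiv 2 ℝ (T → ℝ)).toLinearMap

lemma toeplitzColumns_apply (T : Finset (Fin k × Fin e))
    (B : Fin (k + l - 1) → Matrix (Fin d) (Fin e) ℝ) (z : EuclideanSpace ℝ T) :
    toeplitzColumns T B z = WithLp.toLp 2
      (((toeplitzBlock B).submatrix id (fun t : T => (t : Fin k × Fin e))).mulVec z.ofLp) :=
  rfl

variable {Ω : Type*} [MeasurableSpace Ω] {μ : Measure Ω} [IsProbabilityMeasure μ]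
  {Φ : Fin (k + l - 1) → Fin d → Fin e → Ω → ℝ}

lemma measure_toeplitzColumns_deviation_le (P : EntryDistribution)
    (hind : iIndepFun (fun t : Fin (k + l - 1) × Fin d × Fin e => Φ t.1 t.2.1 t.2.2) μ)
    (hlaw : ∀ t a b, HasLaw (Φ t a b) (P.law (l * d)) μ) (hn : 0 < l * d) {q : ℕ} (hq : 0 < q)
    {T : Finset (Fin k × Fin e)} {f : Fin l → Fin q} (hf : IsBlockRowColoring T f)
    {η : ℝ} (hη0 : 0 < η) (hη1 : η ≤ 1) (v : EuclideanSpace ℝ T) :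
    μ {ω | ¬ |‖toeplitzColumns T (fun t => Matrix.of fun a b => Φ t a b ω) v‖ ^ 2 - ‖v‖ ^ 2| ≤
        η * ‖v‖ ^ 2} ≤
      ENNReal.ofReal (2 * Real.exp (-(η ^ 2 / (4 * mgfSqConst)) * (l * d : ℕ) / q)) := by
  by_cases hv : v = 0
  · simp [hv]
  have hn' : (0 : ℝ) < (l * d : ℕ) := Nat.cast_pos.2 hn
  have hv0 : 0 < ‖v‖ := norm_pos_iff.2 hv
  set ξ : Fin (k + l - 1) × Fin d × Fin e → Ω → ℝ :=
    fun t ω => √(l * d : ℕ) * Φ t.1 t.2.1 t.2.2 ω with hξ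
  have hξind : iIndepFun ξ μ := hind.comp (fun _ y => √(l * d : ℕ) * y)
    fun _ => measurable_const_mul _
  have hprop := fun t : Fin (k + l - 1) × Fin d × Fin e =>
    normalized_entry_properties P hn (hlaw t.1 t.2.1 t.2.2)
  have hx : ∑ t : T, (v t / ‖v‖) ^ 2 = 1 := by
    simp_rw [div_pow]
    rw [← Finset.sum_div, ← EuclideanSpace.real_norm_sq_eq, div_self (by positivity)]
  have key := measure_sum_sq_deviation_le (μ := μ) (ξ := ξ) (R := Fin l × Fin d) hξind
    (fun t => (hprop t).1) (fun t => (hprop t).2.1) (fun t => (hprop t).2.2)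
    (φ := fun p (t : T) => toeplitzIndex p (t : Fin k × Fin e))
    (fun p => (toeplitzIndex_injective p).comp Subtype.val_injective) hq
    (f := fun p => f p.1)
    (fun p p' hp hfp t t' => toeplitzIndex_ne hf hp hfp t.2 t'.2) hx hη0 hη1
  have hcard : Fintype.card (Fin l × Fin d) = l * d := by simp
  rw [hcard] at key
  refine le_trans (measure_mono fun ω hω => ?_) key
  simp only [Set.mem_ofPred_eq, not_le] at hω ⊢
  -- Rescaling to the unit vector `v/‖v‖` and to entries of variance 1 brings out the factor
  -- `‖v‖²/n`.
  have e1 : ‖toeplitzColumns T (fun t => Matrix.of fun a b => Φ t a b ω) v‖ ^ 2 =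
      ‖v‖ ^ 2 / (l * d : ℕ) *
        ∑ p : Fin l × Fin d, (∑ t : T, v t / ‖v‖ * ξ (toeplitzIndex p t) ω) ^ 2 := by
    rw [toeplitzColumns_apply, EuclideanSpace.real_norm_sq_eq, Finset.mul_sum]
    refine Finset.sum_congr rfl fun p _ => ?_
    have e2 : ∑ t : T, v t / ‖v‖ * ξ (toeplitzIndex p t) ω = √(l * d : ℕ) / ‖v‖ *
        ((toeplitzBlock fun t => Matrix.of fun a b => Φ t a b ω).submatrix id
          (fun t : T => (t : Fin k × Fin e))).mulVec v.ofLp p := by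
      rw [Matrix.mulVec, dotProduct, Finset.mul_sum]
      refine Finset.sum_congr rfl fun t _ => ?_
      simp only [hξ, toeplitzIndex, toeplitzBlock, Matrix.submatrix_apply, id, Matrix.of_apply]
      ring
    rw [e2, mul_pow, div_pow, Real.sq_sqrt hn'.le]
    field_simp
  rw [e1] at hω
  set S := ∑ p : Fin l × Fin d, (∑ t : T, v t / ‖v‖ * ξ (toeplitzIndex p t) ω) ^ 2
  have e3 : ‖v‖ ^ 2 / (l * d : ℕ) * S - ‖v‖ ^ 2 = ‖v‖ ^ 2 / (l * d : ℕ) * (S - (l * d : ℕ)) := by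
    field_simp
  rw [e3, abs_mul, abs_of_pos (by positivity)] at hω
  have e4 : η * ‖v‖ ^ 2 = ‖v‖ ^ 2 / (l * d : ℕ) * (η * (l * d : ℕ)) := by
    field_simp
  rw [e4] at hω
  exact (lt_of_mul_lt_mul_left hω (by positivity)).le

lemma measure_not_satisfiesRIP_le (P : EntryDistribution)
    (hind : iIndepFun (fun t : Fin (k + l - 1) × Fin d × Fin e => Φ t.1 t.2.1 t.2.2) μ)
    (hlaw : ∀ t a b, HasLaw (Φ t a b) (P.law (l * d)) μ) (hn : 0 < l * d) {q s : ℕ} (hq : 0 < q)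
    (hs : s ≤ k * e)
    (hf : ∀ T : Finset (Fin k × Fin e), T.card = s →
      ∃ f : Fin l → Fin q, IsBlockRowColoring T f)
    {δ : ℝ} (hδ0 : 0 < δ) (hδ1 : δ < 1) :
    μ {ω | ¬ SatisfiesRIP (toeplitzBlock fun t => Matrix.of fun a b => Φ t a b ω) s δ} ≤
      ENNReal.ofReal ((k * e).choose s * ((1 + 2 / (δ / 8)) ^ s *
        (2 * Real.exp (-((δ / 8) ^ 2 / (4 * mgfSqConst)) * (l * d : ℕ) / q)))) := by
  classical
  have hη : 0 < δ / 8 := by positivity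
  choose net hcard hnet1 hnet2 using fun T : Finset (Fin k × Fin e) =>
    exists_finset_net (E := EuclideanSpace ℝ T) hη
  set bad : ∀ T : Finset (Fin k × Fin e), EuclideanSpace ℝ T → Set Ω := fun T v =>
    {ω | ¬ |‖toeplitzColumns T (fun t => Matrix.of fun a b => Φ t a b ω) v‖ ^ 2 - ‖v‖ ^ 2| ≤
        δ / 8 * ‖v‖ ^ 2} with hbad
  set ε := 2 * Real.exp (-((δ / 8) ^ 2 / (4 * mgfSqConst)) * (l * d : ℕ) / q) with hε
  have hε0 : 0 ≤ ε := by positivity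
  have hsub : {ω | ¬ SatisfiesRIP (toeplitzBlock fun t => Matrix.of fun a b => Φ t a b ω) s δ} ⊆
      ⋃ T ∈ Finset.powersetCard s (Finset.univ : Finset (Fin k × Fin e)),
        ⋃ v ∈ net T, bad T v := by
    intro ω hω
    by_contra hcon
    refine hω (satisfiesRIP_of_card_eq (by simpa using hs) fun T hT z => ?_)
    refine near_isometry_of_net hδ0 hδ1 (hnet1 T) (hnet2 T)
      (toeplitzColumns T fun t => Matrix.of fun a b => Φ t a b ω) (fun v hv => ?_) z
    by_contra hv'
    refine hcon (Set.mem_biUnion (x := T) ?_ (Set.mem_biUnion hv hv'))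
    simp [Finset.mem_powersetCard, hT]
  have hT : ∀ T ∈ Finset.powersetCard s (Finset.univ : Finset (Fin k × Fin e)),
      μ (⋃ v ∈ net T, bad T v) ≤ ENNReal.ofReal ((1 + 2 / (δ / 8)) ^ s * ε) := by
    intro T hT
    have hTs : T.card = s := (Finset.mem_powersetCard.1 hT).2
    obtain ⟨f, hfT⟩ := hf T hTs
    calc μ (⋃ v ∈ net T, bad T v) ≤ ∑ v ∈ net T, μ (bad T v) := measure_biUnion_finset_le _ _
      _ ≤ ∑ _v ∈ net T, ENNReal.ofReal ε := Finset.sum_le_sum fun v _ =>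
          measure_toeplitzColumns_deviation_le P hind hlaw hn hq hfT hη (by linarith) v
      _ = ENNReal.ofReal ((net T).card * ε) := by
          rw [Finset.sum_const, nsmul_eq_mul, ENNReal.ofReal_mul (Nat.cast_nonneg _),
            ENNReal.ofReal_natCast]
      _ ≤ _ := by
          refine ENNReal.ofReal_le_ofReal (mul_le_mul_of_nonneg_right ?_ hε0)
          have := hcard T
          rwa [finrank_euclideanSpace, Fintype.card_coe, hTs] at this
  calc _ ≤ μ (⋃ T ∈ Finset.powersetCard s (Finset.univ : Finset (Fin k × Fin e)),
        ⋃ v ∈ net T, bad T v) := measure_mono hsub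
    _ ≤ ∑ T ∈ Finset.powersetCard s (Finset.univ : Finset (Fin k × Fin e)),
        μ (⋃ v ∈ net T, bad T v) := measure_biUnion_finset_le _ _
    _ ≤ ∑ _T ∈ Finset.powersetCard s (Finset.univ : Finset (Fin k × Fin e)),
        ENNReal.ofReal ((1 + 2 / (δ / 8)) ^ s * ε) := Finset.sum_le_sum hT
    _ = _ := by
        rw [Finset.sum_const, Finset.card_powersetCard, nsmul_eq_mul,
          ENNReal.ofReal_mul (Nat.cast_nonneg _), ENNReal.ofReal_natCast]
        simp

/-- The exponent in the deviation bound for a single vector. -/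
noncomputable def deviationRate (δ : ℝ) : ℝ := (δ / 8) ^ 2 / (4 * mgfSqConst)

lemma deviationRate_pos {δ : ℝ} (hδ0 : 0 < δ) : 0 < deviationRate δ := by
  have := le_mgfSqConst
  unfold deviationRate
  positivity

/-- The contribution of the net and of the choice of the support to the union bound. -/
noncomputable def entropyRate (δ : ℝ) : ℝ := 4 + 3 * Real.log (1 + 2 / (δ / 8))

lemma entropyRate_pos {δ : ℝ} (hδ0 : 0 < δ) : 0 < entropyRate δ := by
  have : 0 ≤ Real.log (1 + 2 / (δ / 8)) := Real.log_nonneg (by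
    have : 0 ≤ 2 / (δ / 8) := by positivity
    linarith)
  unfold entropyRate
  positivity

lemma one_le_log_div {m N : ℕ} (hm : 1 ≤ m) (hN : 3 * m ≤ N) :
    1 ≤ Real.log ((N : ℝ) / m) := by
  have hm' : (0 : ℝ) < m := by positivity
  have h3 : (3 : ℝ) ≤ (N : ℝ) / m := by
    rw [le_div_iff₀ hm']
    exact_mod_cast hN
  rw [Real.le_log_iff_exp_le (by linarith)]
  exact Real.exp_one_lt_three.le.trans h3

lemma le_measureReal_satisfiesRIP (P : EntryDistribution)
    (hind : iIndepFun (fun t : Fin (k + l - 1) × Fin d × Fin e => Φ t.1 t.2.1 t.2.2) μ)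
    (hlaw : ∀ t a b, HasLaw (Φ t a b) (P.law (l * d)) μ) (hn : 0 < l * d) {q m : ℕ} (hq : 0 < q)
    (hm : 1 ≤ m) (hN : 3 * m ≤ k * e)
    (hf : ∀ T : Finset (Fin k × Fin e), T.card = 3 * m →
      ∃ f : Fin l → Fin q, IsBlockRowColoring T f)
    {δ : ℝ} (hδ0 : 0 < δ) (hδ1 : δ < 1)
    (hrows : entropyRate δ * (m * Real.log (((k * e : ℕ) : ℝ) / m)) ≤
      deviationRate δ / 2 * ((l * d : ℕ) / q)) :
    1 - Real.exp (-(deviationRate δ / 2 * ((l * d : ℕ) / q))) ≤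
      μ.real {ω | SatisfiesRIP
        (toeplitzBlock fun t => Matrix.of fun a b => Φ t a b ω) (3 * m) δ} := by
  set G := {ω | SatisfiesRIP
    (toeplitzBlock fun t => Matrix.of fun a b => Φ t a b ω) (3 * m) δ} with hG
  set Λ := Real.log (((k * e : ℕ) : ℝ) / m) with hΛ
  set y : ℝ := (l * d : ℕ) / q with hy
  have hΛ1 : 1 ≤ Λ := one_le_log_div hm hN
  have hm' : (1 : ℝ) ≤ m := by exact_mod_cast hm
  have hD : 0 < 1 + 2 / (δ / 8) := by positivity
  have hlogD : 0 ≤ Real.log (1 + 2 / (δ / 8)) := Real.log_nonneg (by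
    have : 0 ≤ 2 / (δ / 8) := by positivity
    linarith)
  have hbad := measure_not_satisfiesRIP_le P hind hlaw hn hq hN hf hδ0 hδ1
  have hnum : (k * e).choose (3 * m) * ((1 + 2 / (δ / 8)) ^ (3 * m) *
      (2 * Real.exp (-((δ / 8) ^ 2 / (4 * mgfSqConst)) * (l * d : ℕ) / q))) ≤
      Real.exp (-(deviationRate δ / 2 * y)) := by
    have h1 := choose_three_mul_le hm hN
    have h2 : (1 + 2 / (δ / 8)) ^ (3 * m) =
        Real.exp (3 * m * Real.log (1 + 2 / (δ / 8))) := by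
      rw [← Real.exp_log (pow_pos hD (3 * m)), Real.log_pow]
      push_cast
      rfl
    have h3 : (2 : ℝ) ≤ Real.exp 1 := by linarith [Real.add_one_le_exp 1]
    have h4 : -((δ / 8) ^ 2 / (4 * mgfSqConst)) * (l * d : ℕ) / q = -(deviationRate δ * y) := by
      rw [hy, deviationRate]; ring
    rw [h2, h4]
    calc _ ≤ Real.exp (3 * m * Λ) * (Real.exp (3 * m * Real.log (1 + 2 / (δ / 8))) *
          (Real.exp 1 * Real.exp (-(deviationRate δ * y)))) := by gcongr
      _ = Real.exp (3 * m * Λ + (3 * m * Real.log (1 + 2 / (δ / 8)) +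
          (1 + -(deviationRate δ * y)))) := by simp only [Real.exp_add]
      _ ≤ _ := by
          rw [Real.exp_le_exp]
          -- As `m Λ ≥ 1`, supports, the factor `2 ≤ e` and the net cost at most `3`, `1` and `3 log
          -- (1 + 16/δ)` times `m Λ`, in total `entropyRate δ * (m Λ)`. This uses half of the
          -- exponent and leaves the other half.
          have h5 : 1 ≤ m * Λ := one_le_mul_of_one_le_of_one_le hm' hΛ1
          have h6 : m * Real.log (1 + 2 / (δ / 8)) ≤ Real.log (1 + 2 / (δ / 8)) * (m * Λ) := by
            rw [mul_comm (m : ℝ)]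
            refine mul_le_mul_of_nonneg_left ?_ hlogD
            nlinarith
          rw [entropyRate] at hrows
          linarith
  -- Subadditivity alone suffices here, so measurability of the RIP event is not needed.
  have hone : (1 : ℝ≥0∞) ≤ μ G + μ Gᶜ := by
    rw [← measure_univ (μ := μ), ← Set.union_compl_self G]
    exact measure_union_le _ _
  have hreal : 1 ≤ μ.real G + μ.real Gᶜ := by
    rw [Measure.real, Measure.real, ← ENNReal.toReal_add (measure_ne_top _ _) (measure_ne_top _ _)]
    simpa using ENNReal.toReal_mono (by finiteness) hone
  have hcompl : μ.real Gᶜ ≤ Real.exp (-(deviationRate δ / 2 * y)) :=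
    ENNReal.toReal_le_of_le_ofReal (Real.exp_pos _).le
      (hbad.trans (ENNReal.ofReal_le_ofReal hnum))
  linarith

end Toeplitz

/-! ### Choice of constants and the two regimes -/

theorem theorem1 (δ : ℝ) (hδ0 : 0 < δ) (hδ1 : δ < 1) :
    ∃ c₁ c₂ : ℝ, 0 < c₁ ∧ 0 < c₂ ∧
      ∀ (P : EntryDistribution) (m k l d e n N : ℕ),
        1 ≤ m → 1 ≤ l → n = l * d → N = k * e → 3 * m ≤ N →
      ∀ (Ω : Type*) [MeasurableSpace Ω] (μ : Measure Ω) [IsProbabilityMeasure μ]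
        (Φ : Fin (k + l - 1) → Fin d → Fin e → Ω → ℝ),
        iIndepFun (fun t : Fin (k + l - 1) × Fin d × Fin e => Φ t.1 t.2.1 t.2.2) μ →
        (∀ t a b, HasLaw (Φ t a b) (P.law n) μ) →
        (l ≤ 3 * m * (3 * m - 1) →
          c₁ * l * m * Real.log ((N : ℝ) / m) ≤ n →
          1 - Real.exp (-c₂ * n / l) ≤
            μ.real {ω | SatisfiesRIP
              (toeplitzBlock fun t => Matrix.of fun a b => Φ t a b ω) (3 * m) δ}) ∧
        (3 * m * (3 * m - 1) < l →
          c₁ * (m : ℝ) ^ 3 * Real.log ((N : ℝ) / m) ≤ n →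
          1 - Real.exp (-c₂ * n / (m : ℝ) ^ 2) ≤
            μ.real {ω | SatisfiesRIP
              (toeplitzBlock fun t => Matrix.of fun a b => Φ t a b ω) (3 * m) δ}) := by
  have hκ := deviationRate_pos hδ0
  have hH := entropyRate_pos hδ0
  set κ := deviationRate δ with hκdef
  set H := entropyRate δ with hHdef
  -- The 18 is `2 · 9`: half of the rate is spent on entropy, and `q ≤ 9 m²` in the second regime.
  -- The first regime has room to spare.
  refine ⟨18 * H / κ, κ / 18, by positivity, by positivity, ?_⟩
  rintro P m k l d e n N hm hl rfl rfl hN Ω _ μ _ Φ hind hlaw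
  have hm' : (0 : ℝ) < m := by positivity
  have hl' : (0 : ℝ) < l := by positivity
  have hΛ1 := one_le_log_div hm hN
  set Λ := Real.log (((k * e : ℕ) : ℝ) / m) with hΛ
  constructor
  · intro _ hrows
    -- Positivity of `d` comes from the row condition, whose left side is positive.
    have hn' : (0 : ℝ) < (l * d : ℕ) := lt_of_lt_of_le (by positivity) hrows
    have hmain := le_measureReal_satisfiesRIP P hind hlaw (Nat.cast_pos.1 hn') hl hm hN
      (fun T _ => ⟨id, isBlockRowColoring_id T⟩) hδ0 hδ1 (by
        have h1 : 18 * (H * (m * Λ)) ≤ κ * ((l * d : ℕ) / l) := by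
          rw [← mul_div_assoc, le_div_iff₀ hl']
          calc 18 * (H * (m * Λ)) * l = κ * (18 * H / κ * l * m * Λ) := by field_simp
            _ ≤ _ := by gcongr
        have h2 : 0 ≤ H * (m * Λ) := by positivity
        linarith)
    refine le_trans ?_ hmain
    gcongr
    have h3 : 0 ≤ κ * ((l * d : ℕ) / (l : ℝ)) := by positivity
    calc -(κ / 2 * ((l * d : ℕ) / (l : ℝ))) ≤ -(κ * ((l * d : ℕ) / (l : ℝ)) / 18) := by linarith
      _ = _ := by ring
  · intro _ hrows
    have hn' : (0 : ℝ) < (l * d : ℕ) := lt_of_lt_of_le (by positivity) hrows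
    set q := 3 * m * (3 * m - 1) + 1 with hq
    have hqle : (q : ℝ) ≤ 9 * (m : ℝ) ^ 2 := by
      have h : q ≤ 9 * m ^ 2 := by
        obtain ⟨j, hj⟩ : ∃ j, 3 * m = j + 1 := ⟨3 * m - 1, by omega⟩
        have : 9 * m ^ 2 = (3 * m) * (3 * m) := by ring
        rw [hq, this, hj, Nat.add_sub_cancel]
        nlinarith
      exact_mod_cast h
    have hq0 : (0 : ℝ) < q := by positivity
    have hdiv : ((l * d : ℕ) : ℝ) / (m : ℝ) ^ 2 ≤ 9 * ((l * d : ℕ) / q) := by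
      rw [← mul_div_assoc, div_le_div_iff₀ (by positivity) hq0]
      calc ((l * d : ℕ) : ℝ) * q ≤ (l * d : ℕ) * (9 * (m : ℝ) ^ 2) := by gcongr
        _ = _ := by ring
    have hmain := le_measureReal_satisfiesRIP P hind hlaw (Nat.cast_pos.1 hn') (q := q)
      (by omega) hm hN (fun T hT => by
        have := exists_isBlockRowColoring l T
        rwa [hT] at this) hδ0 hδ1 (by
        have h1 : 18 * (H * (m * Λ)) ≤ κ * ((l * d : ℕ) / (m : ℝ) ^ 2) := by
          rw [← mul_div_assoc, le_div_iff₀ (by positivity)]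
          calc 18 * (H * (m * Λ)) * (m : ℝ) ^ 2 = κ * (18 * H / κ * (m : ℝ) ^ 3 * Λ) := by
                field_simp
            _ ≤ _ := by gcongr
        have h2 := mul_le_mul_of_nonneg_left hdiv hκ.le
        linarith)
    refine le_trans ?_ hmain
    gcongr
    have h2 := mul_le_mul_of_nonneg_left hdiv hκ.le
    calc -(κ / 2 * ((l * d : ℕ) / (q : ℝ))) ≤ -(κ * ((l * d : ℕ) / (m : ℝ) ^ 2) / 18) := by
          linarith
      _ = _ := by ring
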